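/- Let $M$ be a compact topological space with a finite Radon measure $\mu$. Let $\mathcal E$ be a Dirichlet form on $L^2(M,\mu)$: a nonnegative, closed, symmetric bilinear form with dense domain $\mathcal D(\mathcal E)\subset L^2(M,\mu)$ such that, writing $\mathcal E(v)=\mathcal E(v,v)$, for every $v\in\mathcal D(\mathcal E)$ one has $|v|\in\mathcal D(\mathcal E)$ and $\mathcal E(|v|)\le\mathcal E(v)$, and, if $v\ge 0$, also $\min(v,1)\in\mathcal D(\mathcal E)$ and $\mathcal E(\min(v,1))\le\mathcal E(v)$. Assume that: (1) $\mathcal E$ is regular: $\mathcal D(\mathcal E)\cap C^0(M)$ is dense in $\mathcal D(\mathcal E)$ for the norm $(\mathcal E(v)+\|v\|_{L^2}^2)^{1/2}$ and in $C^0(M)$ for the uniform norm; (2) $\mathcal E$ is strongly local: $\mathcal E(u,v)=0$ whenever $u,v\in\mathcal D(\mathcal E)$ and $u$ is constant in a neighborhood of $\operatorname{supp} v$; (3) the Sobolev inequality holds: for some $\nu>2$ and $A,B>0$, $$\|v\|^2_{L^{2\nu/(\nu-2)}}\le A\,\mathcal E(v)+B\,\|v\|_{L^2}^2\qquad\text{for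 all } v\in\mathcal D(\mathcal E).$$ Let $W\in L^1(M,\mu)$ be real-valued with $W_+=\max(W,0)$ infinitesimally form bounded: for every $\varepsilon>0$ there is $c(\varepsilon)$ such that $\int_M W_+v^2\,d\mu\le\varepsilon\,\mathcal E(v)+c(\varepsilon)\int_M v^2\,d\mu$ for all $v\in\mathcal D(\mathcal E)$. Let $L$ be the generator of $\mathcal E$ and let $u\in\mathcal D(\mathcal E)$, $u\ge 0$, be a weak solution of $Lu=Wu$, i.e. for every bounded $\varphi\in\mathcal D(\mathcal E)$ (in particular, it suffices that this hold for all $\varphi\in\mathcal D(\mathcal E)$) the function $Wu\varphi$ is integrable and $$\mathcal E(u,\varphi)=\int_M W u\varphi\,d\mu .$$ Then $u\in L^q(M,\mu)$ for every real $q\ge 2$. -/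

import Mathlib

open MeasureTheory Filter Topology

/-- A Dirichlet form on `L²(M, μ)`, for a finite measure `μ`: a densely defined, nonnegative, closed
symmetric bilinear form that satisfies the two Beurling-Deny (Markov) conditions. -/
structure DirichletForm {M : Type*} [MeasurableSpace M] (μ : Measure M) [IsFiniteMeasure μ] where
  /-- the domain `𝒟(ℰ)` -/
  domain : Submodule ℝ (Lp ℝ 2 μ)
  /-- the bilinear form `ℰ(·, ·)` -/
  form : domain →ₗ[ℝ] domain →ₗ[ℝ] ℝ
  dense_domain : Dense (domain : Set (Lp ℝ 2 μ))
  symm : ∀ u v : domain, form u v = form v u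
  nonneg : ∀ v : domain, 0 ≤ form v v
  /-- `𝒟(ℰ)` is complete for the norm whose square is `ℰ₁(v) = ℰ(v, v) + ‖v‖²_{L²}` -/
  closed : ∀ v : ℕ → domain,
    Tendsto (fun p : ℕ × ℕ => form (v p.1 - v p.2) (v p.1 - v p.2) + ‖v p.1 - v p.2‖ ^ 2)
      atTop (𝓝 0) →
    ∃ w : domain, Tendsto (fun n => form (v n - w) (v n - w) + ‖v n - w‖ ^ 2) atTop (𝓝 0)
  abs_contraction : ∀ v : domain, ∃ h : |(v : Lp ℝ 2 μ)| ∈ domain,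
    form ⟨|(v : Lp ℝ 2 μ)|, h⟩ ⟨|(v : Lp ℝ 2 μ)|, h⟩ ≤ form v v
  inf_one_contraction : ∀ v : domain, 0 ≤ (v : Lp ℝ 2 μ) →
    ∃ h : (v : Lp ℝ 2 μ) ⊓ Lp.const 2 μ (1 : ℝ) ∈ domain,
      form ⟨(v : Lp ℝ 2 μ) ⊓ Lp.const 2 μ (1 : ℝ), h⟩
        ⟨(v : Lp ℝ 2 μ) ⊓ Lp.const 2 μ (1 : ℝ), h⟩ ≤ form v v

namespace DirichletForm

section Measure

variable {M : Type*} [MeasurableSpace M] {μ : Measure M} [IsFiniteMeasure μ]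

/-- The Sobolev inequality `‖v‖²_{L^{2ν/(ν-2)}} ≤ A ℰ(v) + B ‖v‖²_{L²}` for all `v ∈ 𝒟(ℰ)`. The
left-hand side is an extended real number, so the membership of `v` in `L^{2ν/(ν-2)}` is included. -/
def SobolevInequality (E : DirichletForm μ) (ν A B : ℝ) : Prop :=
  ∀ v : E.domain,
    eLpNorm ((v : Lp ℝ 2 μ) : M → ℝ) (ENNReal.ofReal (2 * ν / (ν - 2))) μ ^ 2
      ≤ ENNReal.ofReal (A * E.form v v + B * ‖v‖ ^ 2)

/-- A nonnegative function `W` is infinitesimally form bounded with respect to `ℰ`: for every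
`ε > 0` there is `c(ε)` such that `∫ W v² dμ ≤ ε ℰ(v) + c(ε) ∫ v² dμ` for all `v ∈ 𝒟(ℰ)`. -/
def InfinitesimallyFormBounded (E : DirichletForm μ) (W : M → ℝ) : Prop :=
  ∀ ε : ℝ, 0 < ε → ∃ c : ℝ, 0 ≤ c ∧ ∀ v : E.domain,
    ∫⁻ x, ENNReal.ofReal (W x * ((v : Lp ℝ 2 μ) x) ^ 2) ∂μ
      ≤ ENNReal.ofReal (ε * E.form v v + c * ‖v‖ ^ 2)

/-- `u ∈ 𝒟(ℰ)` is a (weak) solution of `L u = W u`, where `L` is the generator of `ℰ`: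
`ℰ(u, φ) = ∫ W u φ dμ`, the integral being absolutely convergent, for every (essentially) bounded
`φ ∈ 𝒟(ℰ)`. This is implied by the same identity for all `φ ∈ 𝒟(ℰ)`, in particular by the operator
identity `L u = W u` in `L²`. It is also implied by the identity for all `φ` in the form domain
`{φ ∈ 𝒟(ℰ) : ∫ |W| φ² dμ < ∞}` when `W` is integrable and `u` belongs to that form domain. -/
def IsSolution (E : DirichletForm μ) (W : M → ℝ) (u : E.domain) : Prop :=
  ∀ φ : E.domain, (∃ C : ℝ, ∀ᵐ x ∂μ, |(φ : Lp ℝ 2 μ) x| ≤ C) →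
    Integrable (fun x => W x * (u : Lp ℝ 2 μ) x * (φ : Lp ℝ 2 μ) x) μ ∧
    E.form u φ = ∫ x, W x * (u : Lp ℝ 2 μ) x * (φ : Lp ℝ 2 μ) x ∂μ

end Measure

section Topology

variable {M : Type*} [TopologicalSpace M] [MeasurableSpace M] {μ : Measure M} [IsFiniteMeasure μ]

/-- The support of (the class of) a function `v`: the complement of the union of all open sets on
which `v = 0` almost everywhere. -/
def essSupport (μ : Measure M) (v : M → ℝ) : Set M :=
  {x | ∀ U : Set M, IsOpen U → x ∈ U → ¬ ∀ᵐ y ∂μ, y ∈ U → v y = 0}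

/-- Strong locality: `ℰ(u, v) = 0` if `u` is constant in a neighborhood of the support of `v`. -/
def StronglyLocal (E : DirichletForm μ) : Prop :=
  ∀ u v : E.domain,
    (∃ (U : Set M) (c : ℝ), IsOpen U ∧ essSupport μ ((v : Lp ℝ 2 μ) : M → ℝ) ⊆ U ∧
      ∀ᵐ x ∂μ, x ∈ U → (u : Lp ℝ 2 μ) x = c) →
    E.form u v = 0

/-- Regularity: `𝒟(ℰ) ∩ C⁰(M)` is dense in `𝒟(ℰ)` for the norm `ℰ₁^{1/2}` and in `C⁰(M)` for the
uniform norm. -/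
def IsRegular [CompactSpace M] [BorelSpace M] (E : DirichletForm μ) : Prop :=
  (∀ v : E.domain, ∀ ε : ℝ, 0 < ε →
    ∃ (f : C(M, ℝ)) (hf : ContinuousMap.toLp 2 μ ℝ f ∈ E.domain),
      E.form (v - ⟨ContinuousMap.toLp 2 μ ℝ f, hf⟩) (v - ⟨ContinuousMap.toLp 2 μ ℝ f, hf⟩)
        + ‖v - ⟨ContinuousMap.toLp 2 μ ℝ f, hf⟩‖ ^ 2 < ε) ∧
  Dense {f : C(M, ℝ) | ContinuousMap.toLp 2 μ ℝ f ∈ E.domain}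

end Topology

end DirichletForm

/-!
Moser iteration: testing `Lu = Wu` with a power of `u` bounds the energy of another power, form
boundedness of `W₊` absorbs the potential term into that energy, and the Sobolev inequality then
improves the integrability of `u` by the factor `ν / (ν - 2)`. Instead of a chain rule, the Markov
property alone is used. Cut `u` into slices `s i = min u (t (i + 1)) - min u (t i)`. A slice `s j`
with `i < j` lives where `s i` is already saturated, so the Markov property gives
`ℰ(s i, s j) ≥ 0`. Hence, for `g = ∑ i, b i • s i` and `f = ∑ i, b i ^ 2 • s i`, the inequality
`2 * b i * b j ≤ b i ^ 2 + b j ^ 2` yields `ℰ(g, g) ≤ ℰ(u, f)`. For dyadic levels and slopes `b i`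
growing like `2 ^ (i * σ)`, `g` and `f` are comparable to `u ^ (σ + 1)` and `u ^ (2 * σ + 1)`.
-/

/-- The part of `a` that lies between the levels `t i` and `t (i + 1)`. -/
def levelSlice (t : ℕ → ℝ) (i : ℕ) (a : ℝ) : ℝ := min a (t (i + 1)) - min a (t i)

/-- The value at `a` of the piecewise linear function with slope `b i` on `[t i, t (i + 1)]` for
`i < m` that vanishes at `t 0` and is constant beyond `t m`. Such functions replace the powers of
the solution in the Moser iteration, since they are combinations of truncations. -/
def piecewiseLinear (t b : ℕ → ℝ) (m : ℕ) (a : ℝ) : ℝ :=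
  ∑ i ∈ Finset.range m, b i * levelSlice t i a

section PiecewiseLinear

variable {t b c : ℕ → ℝ} {i k m : ℕ} {a C : ℝ}

theorem levelSlice_nonneg (ht : Monotone t) (i : ℕ) (a : ℝ) : 0 ≤ levelSlice t i a :=
  sub_nonneg.2 (min_le_min_left a (ht i.le_succ))

theorem levelSlice_le (ht : Monotone t) (i : ℕ) (a : ℝ) : levelSlice t i a ≤ t (i + 1) - t i := by
  have hi := ht i.le_succ
  unfold levelSlice
  grind

theorem levelSlice_of_le (ht : Monotone t) (ha : a ≤ t i) : levelSlice t i a = 0 := by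
  rw [levelSlice, min_eq_left ha, min_eq_left (ha.trans (ht i.le_succ)), sub_self]

theorem levelSlice_of_ge (ht : Monotone t) (ha : t (i + 1) ≤ a) :
    levelSlice t i a = t (i + 1) - t i := by
  rw [levelSlice, min_eq_right ha, min_eq_right ((ht i.le_succ).trans ha)]

theorem levelSlice_min (ht : Monotone t) (him : i < m) (a : ℝ) :
    levelSlice t i (min a (t m)) = levelSlice t i a := by
  rw [levelSlice, levelSlice, min_assoc, min_assoc, min_eq_right (ht him), min_eq_right (ht him.le)]

theorem sum_levelSlice (ha : t 0 ≤ a) (m : ℕ) :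
    ∑ i ∈ Finset.range m, levelSlice t i a = min a (t m) - t 0 := by
  rw [← min_eq_right ha]
  exact Finset.sum_range_sub (fun i => min a (t i)) m

theorem exists_level_le_le (ha₀ : t 0 ≤ a) (hm : 0 < m) (ham : a ≤ t m) :
    ∃ k < m, t k ≤ a ∧ a ≤ t (k + 1) := by
  induction m, hm using Nat.le_induction with
  | base => exact ⟨0, zero_lt_one, ha₀, ham⟩
  | succ m _ ih =>
    rcases le_total a (t m) with h | h
    · obtain ⟨k, hkm, hk⟩ := ih h
      exact ⟨k, hkm.trans m.lt_succ_self, hk⟩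
    · exact ⟨m, m.lt_succ_self, h, ham⟩

theorem piecewiseLinear_nonneg (ht : Monotone t) (hb : ∀ i, 0 ≤ b i) (m : ℕ) (a : ℝ) :
    0 ≤ piecewiseLinear t b m a :=
  Finset.sum_nonneg fun i _ => mul_nonneg (hb i) (levelSlice_nonneg ht i a)

theorem piecewiseLinear_one (ha : t 0 ≤ a) (m : ℕ) :
    piecewiseLinear t 1 m a = min a (t m) - t 0 := by
  simp only [piecewiseLinear, Pi.one_apply, one_mul, sum_levelSlice ha]

theorem piecewiseLinear_min (ht : Monotone t) (b : ℕ → ℝ) (m : ℕ) (a : ℝ) :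
    piecewiseLinear t b m (min a (t m)) = piecewiseLinear t b m a :=
  Finset.sum_congr rfl fun i hi => by rw [levelSlice_min ht (Finset.mem_range.1 hi)]

theorem piecewiseLinear_le_mul (ht : Monotone t) (hak : a ≤ t (k + 1))
    (hbc : ∀ i ≤ k, b i ≤ C * c i) (m : ℕ) :
    piecewiseLinear t b m a ≤ C * piecewiseLinear t c m a := by
  rw [piecewiseLinear, piecewiseLinear, Finset.mul_sum]
  refine Finset.sum_le_sum fun i _ => ?_
  rw [← mul_assoc]
  rcases le_or_gt i k with hik | hki
  · exact mul_le_mul_of_nonneg_right (hbc i hik) (levelSlice_nonneg ht i a)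
  · rw [levelSlice_of_le ht (hak.trans (ht hki)), mul_zero, mul_zero]

theorem mul_levelSlice_le_piecewiseLinear (ht : Monotone t) (hb : ∀ i, 0 ≤ b i) (hkm : k < m)
    (a : ℝ) : b k * levelSlice t k a ≤ piecewiseLinear t b m a :=
  Finset.single_le_sum (f := fun i => b i * levelSlice t i a)
    (fun i _ => mul_nonneg (hb i) (levelSlice_nonneg ht i a)) (Finset.mem_range.2 hkm)

end PiecewiseLinear

/-- The levels `0, 1, 2, 4, 8, …` at which a nonnegative function is cut into slices. -/
def dyadicLevel : ℕ → ℝ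
  | 0 => 0
  | k + 1 => 2 ^ k

theorem dyadicLevel_monotone : Monotone dyadicLevel := by
  refine monotone_nat_of_le_succ fun k => ?_
  cases k with
  | zero => exact zero_le_one.trans_eq (pow_zero 2).symm
  | succ k => exact pow_le_pow_right₀ one_le_two k.le_succ

theorem tendsto_dyadicLevel : Tendsto dyadicLevel atTop atTop :=
  (tendsto_add_atTop_iff_nat 1).1 (tendsto_pow_atTop_atTop_of_one_lt one_lt_two)

theorem exists_dyadicLevel_le_le {a : ℝ} (ha : 0 ≤ a) :
    ∃ k, dyadicLevel k ≤ a ∧ a ≤ dyadicLevel (k + 1) := by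
  obtain ⟨m, ham, hm⟩ :=
    ((tendsto_dyadicLevel.eventually_ge_atTop a).and (eventually_gt_atTop 0)).exists
  obtain ⟨k, -, hk⟩ := exists_level_le_le (t := dyadicLevel) ha hm ham
  exact ⟨k, hk⟩

theorem piecewiseLinear_le_mul_min {b : ℕ → ℝ} {C a : ℝ} (hbC : ∀ i, b i ≤ C) (ha : 0 ≤ a)
    (m : ℕ) : piecewiseLinear dyadicLevel b m a ≤ C * min a (dyadicLevel m) := by
  obtain ⟨k, -, hak⟩ := exists_dyadicLevel_le_le ha
  calc piecewiseLinear dyadicLevel b m a ≤ C * piecewiseLinear dyadicLevel 1 m a :=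
        piecewiseLinear_le_mul dyadicLevel_monotone hak
          (fun i _ => (hbC i).trans_eq (mul_one C).symm) m
    _ = C * min a (dyadicLevel m) := by
        rw [piecewiseLinear_one (t := dyadicLevel) ha, dyadicLevel, sub_zero]

/-- Nonnegative, nondecreasing slopes that grow at most by the factor `β` from one dyadic interval
to the next, like the derivative of a power. -/
structure IsDoubling (β : ℝ) (b : ℕ → ℝ) : Prop where
  one_le : 1 ≤ β
  nonneg : ∀ i, 0 ≤ b i
  monotone : Monotone b
  succ_le : ∀ i, b (i + 1) ≤ β * b i

namespace IsDoubling

variable {β : ℝ} {b : ℕ → ℝ} {k m : ℕ} {a : ℝ}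

theorem piecewiseLinear_sq_le (hb : IsDoubling β b) (hak : a ≤ dyadicLevel (k + 1)) (m : ℕ) :
    piecewiseLinear dyadicLevel (b ^ 2) m a ≤ b k * piecewiseLinear dyadicLevel b m a :=
  piecewiseLinear_le_mul dyadicLevel_monotone hak (fun i hik => by
    rw [Pi.pow_apply, sq]
    exact mul_le_mul_of_nonneg_right (hb.monotone hik) (hb.nonneg i)) m

theorem slope_mul_le (hb : IsDoubling β b) (ha : 0 ≤ a) (hkm : k < m) (hka : dyadicLevel k ≤ a)
    (hak : a ≤ dyadicLevel (k + 1)) : b k * a ≤ 4 * β * piecewiseLinear dyadicLevel b m a := by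
  have hβ := hb.one_le
  set G := piecewiseLinear dyadicLevel b m a
  have hG : 0 ≤ G := piecewiseLinear_nonneg dyadicLevel_monotone hb.nonneg m a
  cases k with
  | zero =>
    have hslice : levelSlice dyadicLevel 0 a = a := by
      rw [levelSlice, min_eq_left hak, dyadicLevel, min_eq_right ha, sub_zero]
    have hfirst : b 0 * a ≤ G := by
      simpa only [hslice] using
        mul_levelSlice_le_piecewiseLinear dyadicLevel_monotone hb.nonneg hkm a
    nlinarith
  | succ j =>
    have hlast : b j * (dyadicLevel (j + 1) - dyadicLevel j) ≤ G := by
      rw [← levelSlice_of_ge dyadicLevel_monotone hka]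
      exact mul_levelSlice_le_piecewiseLinear dyadicLevel_monotone hb.nonneg
        (j.lt_succ_self.trans hkm) a
    have hheight : dyadicLevel (j + 2) ≤ 4 * (dyadicLevel (j + 1) - dyadicLevel j) := by
      cases j with
      | zero => norm_num [dyadicLevel]
      | succ j => simp only [dyadicLevel, pow_succ]; linarith
    calc b (j + 1) * a ≤ β * b j * (4 * (dyadicLevel (j + 1) - dyadicLevel j)) :=
          mul_le_mul (hb.succ_le j) (hak.trans hheight) ha ((hb.nonneg _).trans (hb.succ_le j))
      _ = 4 * β * (b j * (dyadicLevel (j + 1) - dyadicLevel j)) := by ring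
      _ ≤ 4 * β * G := by gcongr

theorem mul_piecewiseLinear_sq_le (hb : IsDoubling β b) (ha : 0 ≤ a) (hm : 0 < m)
    (ham : a ≤ dyadicLevel m) :
    a * piecewiseLinear dyadicLevel (b ^ 2) m a
      ≤ 4 * β * piecewiseLinear dyadicLevel b m a ^ 2 := by
  obtain ⟨k, hkm, hka, hak⟩ := exists_level_le_le (t := dyadicLevel) ha hm ham
  set G := piecewiseLinear dyadicLevel b m a
  have hG : 0 ≤ G := piecewiseLinear_nonneg dyadicLevel_monotone hb.nonneg m a
  calc a * piecewiseLinear dyadicLevel (b ^ 2) m a ≤ a * (b k * G) :=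
        mul_le_mul_of_nonneg_left (hb.piecewiseLinear_sq_le hak m) ha
    _ = b k * a * G := by ring
    _ ≤ 4 * β * G * G := mul_le_mul_of_nonneg_right (hb.slope_mul_le ha hkm hka hak) hG
    _ = 4 * β * G ^ 2 := by ring

end IsDoubling

/-- The slopes `2 ^ (i * σ)` of a piecewise linear substitute for the power `a ^ (σ + 1)`, bounded
by `N ^ σ`. -/
noncomputable def truncPowSlope (σ N : ℝ) (i : ℕ) : ℝ := min (2 ^ i) N ^ σ

section TruncPowSlope

variable {σ N a : ℝ} {m : ℕ}

theorem isDoubling_truncPowSlope (hσ : 0 ≤ σ) (hN : 0 ≤ N) :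
    IsDoubling (2 ^ σ) (truncPowSlope σ N) where
  one_le := Real.one_le_rpow one_le_two hσ
  nonneg i := by unfold truncPowSlope; positivity
  monotone i j hij := by unfold truncPowSlope; gcongr; exact one_le_two
  succ_le i := by
    have hmin : min (2 ^ (i + 1)) N ≤ 2 * min (2 ^ i) N := by
      rw [mul_min_of_nonneg _ _ zero_le_two, pow_succ']
      exact min_le_min_left _ (by linarith)
    rw [truncPowSlope, truncPowSlope, ← Real.mul_rpow zero_le_two (by positivity)]
    exact Real.rpow_le_rpow (by positivity) hmin hσ

theorem truncPowSlope_le (hσ : 0 ≤ σ) (hN : 0 ≤ N) (i : ℕ) : truncPowSlope σ N i ≤ N ^ σ :=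
  Real.rpow_le_rpow (by positivity) (min_le_right _ _) hσ

theorem truncPowSlope_le_one_add {k : ℕ} (hσ : 0 ≤ σ) (hN : 0 ≤ N) (ha : 0 ≤ a)
    (hka : dyadicLevel k ≤ a) : truncPowSlope σ N k ≤ 1 + 2 ^ σ * a ^ σ := by
  calc truncPowSlope σ N k ≤ (2 ^ k) ^ σ :=
        Real.rpow_le_rpow (by positivity) (min_le_left _ _) hσ
    _ ≤ 1 + (2 * a) ^ σ := by
        cases k with
        | zero =>
          rw [pow_zero, Real.one_rpow]
          exact le_add_of_nonneg_right (by positivity)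
        | succ j =>
          rw [dyadicLevel] at hka
          refine (Real.rpow_le_rpow (by positivity) ?_ hσ).trans (le_add_of_nonneg_left zero_le_one)
          rw [pow_succ']
          linarith
    _ = 1 + 2 ^ σ * a ^ σ := by rw [Real.mul_rpow zero_le_two ha]

theorem piecewiseLinear_truncPowSlope_le (hσ : 0 ≤ σ) (hN : 0 ≤ N) (ha : 0 ≤ a) (m : ℕ) :
    piecewiseLinear dyadicLevel (truncPowSlope σ N) m a ≤ a + 2 ^ σ * a ^ (σ + 1) := by
  have hb := isDoubling_truncPowSlope hσ hN
  obtain ⟨k, hka, hak⟩ := exists_dyadicLevel_le_le ha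
  calc piecewiseLinear dyadicLevel (truncPowSlope σ N) m a
      ≤ truncPowSlope σ N k * piecewiseLinear dyadicLevel 1 m a :=
        piecewiseLinear_le_mul dyadicLevel_monotone hak
          (fun i hik => (hb.monotone hik).trans_eq (mul_one _).symm) m
    _ ≤ truncPowSlope σ N k * a := by
        refine mul_le_mul_of_nonneg_left ?_ (hb.nonneg k)
        rw [piecewiseLinear_one (t := dyadicLevel) ha]
        exact (sub_zero _).trans_le (min_le_left _ _)
    _ ≤ (1 + 2 ^ σ * a ^ σ) * a :=
        mul_le_mul_of_nonneg_right (truncPowSlope_le_one_add hσ hN ha hka) ha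
    _ = a + 2 ^ σ * a ^ (σ + 1) := by
        rw [Real.rpow_add_one' ha (by positivity)]
        ring

theorem min_rpow_le_piecewiseLinear_truncPowSlope (hσ : 0 ≤ σ) (hN : 0 ≤ N) (ha : 0 ≤ a)
    (hm : 0 < m) (hNm : N ≤ dyadicLevel m) :
    min a N ^ (σ + 1) ≤ 4 * 2 ^ σ * piecewiseLinear dyadicLevel (truncPowSlope σ N) m a := by
  rw [← piecewiseLinear_min dyadicLevel_monotone, ← min_eq_right hNm, ← min_assoc]
  set a' := min a (dyadicLevel m)
  have ha' : 0 ≤ a' := le_min ha (hN.trans hNm)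
  rw [min_eq_right hNm]
  obtain ⟨k, hkm, hka, hak⟩ :=
    exists_level_le_le (t := dyadicLevel) ha' hm (min_le_right a (dyadicLevel m))
  calc min a' N ^ (σ + 1) = min a' N ^ σ * min a' N :=
        Real.rpow_add_one' (by positivity) (by positivity)
    _ ≤ truncPowSlope σ N k * a' := by
        unfold truncPowSlope
        gcongr
        · exact hak
        · exact min_le_left _ _
    _ ≤ 4 * 2 ^ σ * piecewiseLinear dyadicLevel (truncPowSlope σ N) m a' :=
        (isDoubling_truncPowSlope hσ hN).slope_mul_le ha' hkm hka hak

end TruncPowSlope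

theorem apply_sum_smul_self_le {ι V : Type*} [AddCommGroup V] [Module ℝ V]
    {B : V →ₗ[ℝ] V →ₗ[ℝ] ℝ} (hB : ∀ v w, B v w = B w v) {s : Finset ι} {v : ι → V}
    (hv : ∀ i ∈ s, ∀ j ∈ s, i ≠ j → 0 ≤ B (v i) (v j)) (b : ι → ℝ) :
    B (∑ i ∈ s, b i • v i) (∑ i ∈ s, b i • v i) ≤ B (∑ i ∈ s, v i) (∑ i ∈ s, b i ^ 2 • v i) := by
  have hexpand : ∀ c d : ι → ℝ, B (∑ i ∈ s, c i • v i) (∑ j ∈ s, d j • v j)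
      = ∑ i ∈ s, ∑ j ∈ s, c i * d j * B (v i) (v j) := fun c d => by
    rw [LinearMap.map_sum₂]
    refine Finset.sum_congr rfl fun i _ => ?_
    rw [map_sum]
    refine Finset.sum_congr rfl fun j _ => ?_
    simp only [map_smul, LinearMap.smul_apply, smul_eq_mul]
    ring
  have hright : B (∑ i ∈ s, v i) (∑ i ∈ s, b i ^ 2 • v i)
      = ∑ i ∈ s, ∑ j ∈ s, b j ^ 2 * B (v i) (v j) := by
    simpa only [one_smul, one_mul] using hexpand (fun _ => 1) (fun i => b i ^ 2)
  have hright_symm : B (∑ i ∈ s, v i) (∑ i ∈ s, b i ^ 2 • v i)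
      = ∑ i ∈ s, ∑ j ∈ s, b i ^ 2 * B (v i) (v j) := by
    rw [hright, Finset.sum_comm]
    exact Finset.sum_congr rfl fun i _ => Finset.sum_congr rfl fun j _ => by rw [hB]
  have hterm : ∀ i ∈ s, ∀ j ∈ s, 2 * (b i * b j * B (v i) (v j))
      ≤ b j ^ 2 * B (v i) (v j) + b i ^ 2 * B (v i) (v j) := fun i hi j hj => by
    rcases eq_or_ne i j with rfl | hij
    · exact le_of_eq (by ring)
    · nlinarith [mul_nonneg (sq_nonneg (b i - b j)) (hv i hi j hj hij)]
  have htwo : 2 * B (∑ i ∈ s, b i • v i) (∑ i ∈ s, b i • v i)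
      ≤ B (∑ i ∈ s, v i) (∑ i ∈ s, b i ^ 2 • v i)
        + B (∑ i ∈ s, v i) (∑ i ∈ s, b i ^ 2 • v i) := by
    nth_rw 1 [hright]
    rw [hexpand, hright_symm, ← Finset.sum_add_distrib, Finset.mul_sum]
    simp only [← Finset.sum_add_distrib, Finset.mul_sum]
    exact Finset.sum_le_sum fun i hi => Finset.sum_le_sum fun j hj => hterm i hi j hj
  linarith

namespace DirichletForm

variable {M : Type*} [MeasurableSpace M] {μ : Measure M} [IsFiniteMeasure μ] (E : DirichletForm μ)

theorem coeFn_add (v w : E.domain) :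
    ((v + w : E.domain) : Lp ℝ 2 μ) =ᵐ[μ] fun x => (v : Lp ℝ 2 μ) x + (w : Lp ℝ 2 μ) x := by
  rw [Submodule.coe_add]
  exact Lp.coeFn_add _ _

theorem coeFn_sub (v w : E.domain) :
    ((v - w : E.domain) : Lp ℝ 2 μ) =ᵐ[μ] fun x => (v : Lp ℝ 2 μ) x - (w : Lp ℝ 2 μ) x := by
  rw [Submodule.coe_sub]
  exact Lp.coeFn_sub _ _

theorem coeFn_smul (c : ℝ) (v : E.domain) :
    ((c • v : E.domain) : Lp ℝ 2 μ) =ᵐ[μ] fun x => c * (v : Lp ℝ 2 μ) x := by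
  rw [Submodule.coe_smul]
  exact Lp.coeFn_smul _ _

theorem coeFn_sum_smul {ι : Type*} [Countable ι] (s : Finset ι) (b : ι → ℝ)
    (v : ι → E.domain) :
    ((∑ i ∈ s, b i • v i : E.domain) : Lp ℝ 2 μ)
      =ᵐ[μ] fun x => ∑ i ∈ s, b i * (v i : Lp ℝ 2 μ) x := by
  rw [Submodule.coe_sum]
  filter_upwards [Lp.coeFn_fun_finsetSum s fun i => ((b i • v i : E.domain) : Lp ℝ 2 μ),
    ae_all_iff.2 fun i => E.coeFn_smul (b i) (v i)] with x hsum hsmul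
  simp only [hsum, hsmul]

theorem exists_min_const {v : E.domain}
    (hv : ∀ᵐ x ∂μ, 0 ≤ (v : Lp ℝ 2 μ) x) {h : ℝ} (hh : 0 ≤ h) :
    ∃ w : E.domain, (∀ᵐ x ∂μ, (w : Lp ℝ 2 μ) x = min ((v : Lp ℝ 2 μ) x) h) ∧
      E.form w w ≤ E.form v v := by
  rcases hh.eq_or_lt with rfl | hh
  · refine ⟨0, ?_, by simpa only [map_zero] using E.nonneg v⟩
    filter_upwards [hv, Lp.coeFn_zero ℝ 2 μ] with x hx hzero
    rw [min_eq_right hx, Submodule.coe_zero, hzero, Pi.zero_apply]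
  have hnonneg : 0 ≤ ((h⁻¹ • v : E.domain) : Lp ℝ 2 μ) := by
    rw [← Lp.coeFn_nonneg]
    filter_upwards [E.coeFn_smul h⁻¹ v, hv] with x hx hvx
    rw [hx]
    exact mul_nonneg (inv_nonneg.2 hh.le) hvx
  obtain ⟨hmem, hle⟩ := E.inf_one_contraction (h⁻¹ • v) hnonneg
  refine ⟨h • ⟨_, hmem⟩, ?_, ?_⟩
  · filter_upwards [E.coeFn_smul h ⟨_, hmem⟩, E.coeFn_smul h⁻¹ v,
      Lp.coeFn_inf ((h⁻¹ • v : E.domain) : Lp ℝ 2 μ) (Lp.const 2 μ (1 : ℝ)),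
      Lp.coeFn_const 2 μ (1 : ℝ)] with x hscale hunscale hinf hone
    rw [hscale]
    simp only [hinf, Pi.inf_apply, hone, Function.const, hunscale]
    rw [mul_min_of_nonneg _ _ hh.le, mul_inv_cancel_left₀ hh.ne', mul_one]
  · have hscale : E.form v v = h * (h * E.form (h⁻¹ • v) (h⁻¹ • v)) := by
      simp only [map_smul, LinearMap.smul_apply, smul_eq_mul]
      field_simp
    rw [hscale]
    simp only [map_smul, LinearMap.smul_apply, smul_eq_mul] at hle ⊢
    gcongr

theorem form_nonneg_of_forall_form_le {v w : E.domain}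
    (h : ∀ τ : ℝ, 0 < τ → E.form v v ≤ E.form (v + τ • w) (v + τ • w)) : 0 ≤ E.form v w := by
  have hquot : ∀ τ : ℝ, 0 < τ → 0 ≤ 2 * E.form v w + τ * E.form w w := fun τ hτ => by
    have hexpand : E.form (v + τ • w) (v + τ • w)
        = E.form v v + τ * (2 * E.form v w + τ * E.form w w) := by
      simp only [map_add, map_smul, LinearMap.add_apply, LinearMap.smul_apply, smul_eq_mul,
        E.symm w v]
      ring
    have := h τ hτ
    rw [hexpand, le_add_iff_nonneg_right] at this
    exact nonneg_of_mul_nonneg_right this hτ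
  have hlim : Tendsto (fun τ => 2 * E.form v w + τ * E.form w w) (𝓝[>] 0)
      (𝓝 (2 * E.form v w + 0 * E.form w w)) :=
    ((by fun_prop : Continuous fun τ : ℝ => 2 * E.form v w + τ * E.form w w).tendsto 0).mono_left
      nhdsWithin_le_nhds
  have := ge_of_tendsto hlim (eventually_mem_nhdsWithin.mono hquot)
  linarith

/-- Adding a multiple of `w` to `v` only changes `v` where it already equals `h`, so truncating
`v + τ • w` at height `h` gives back `v`. -/
theorem form_nonneg_of_saturated {v w : E.domain} {h : ℝ} (hh : 0 ≤ h)
    (hv : ∀ᵐ x ∂μ, 0 ≤ (v : Lp ℝ 2 μ) x ∧ (v : Lp ℝ 2 μ) x ≤ h)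
    (hw : ∀ᵐ x ∂μ, 0 ≤ (w : Lp ℝ 2 μ) x)
    (hvw : ∀ᵐ x ∂μ, (w : Lp ℝ 2 μ) x = 0 ∨ (v : Lp ℝ 2 μ) x = h) :
    0 ≤ E.form v w := by
  refine E.form_nonneg_of_forall_form_le fun τ hτ => ?_
  have hadd : ∀ᵐ x ∂μ, ((v + τ • w : E.domain) : Lp ℝ 2 μ) x
      = (v : Lp ℝ 2 μ) x + τ * (w : Lp ℝ 2 μ) x := by
    filter_upwards [E.coeFn_add v (τ • w), E.coeFn_smul τ w] with x hadd hsmul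
    rw [hadd, hsmul]
  obtain ⟨z, hz, hle⟩ := E.exists_min_const (v := v + τ • w) (by
    filter_upwards [hadd, hv, hw] with x hadd hv hw
    rw [hadd]
    exact add_nonneg hv.1 (mul_nonneg hτ.le hw)) hh
  have hzv : z = v := by
    refine Subtype.ext (Lp.ext ?_)
    filter_upwards [hz, hadd, hv, hw, hvw] with x hz hadd hv hw hvw
    rw [hz, hadd]
    rcases hvw with hw_zero | hv_top
    · rw [hw_zero, mul_zero, add_zero, min_eq_left hv.2]
    · rw [hv_top, min_eq_right (le_add_of_nonneg_right (mul_nonneg hτ.le hw))]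
  rwa [hzv] at hle

theorem form_levelSlice_nonneg {t : ℕ → ℝ} (ht : Monotone t) {i : ℕ}
    {u v w : E.domain}
    (hv : ∀ᵐ x ∂μ, (v : Lp ℝ 2 μ) x = levelSlice t i ((u : Lp ℝ 2 μ) x))
    (hw : ∀ᵐ x ∂μ, 0 ≤ (w : Lp ℝ 2 μ) x)
    (hw_zero : ∀ᵐ x ∂μ, (u : Lp ℝ 2 μ) x ≤ t (i + 1) → (w : Lp ℝ 2 μ) x = 0) :
    0 ≤ E.form v w := by
  refine E.form_nonneg_of_saturated (sub_nonneg.2 (ht i.le_succ)) ?_ hw ?_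
  · filter_upwards [hv] with x hv
    rw [hv]
    exact ⟨levelSlice_nonneg ht i _, levelSlice_le ht i _⟩
  · filter_upwards [hv, hw_zero] with x hv hw_zero
    exact (le_total _ _).imp hw_zero fun h => hv.trans (levelSlice_of_ge ht h)

theorem exists_levelSlice {t : ℕ → ℝ} (ht : ∀ i, 0 ≤ t i) {u : E.domain}
    (hu : ∀ᵐ x ∂μ, 0 ≤ (u : Lp ℝ 2 μ) x) :
    ∃ s : ℕ → E.domain, ∀ i, ∀ᵐ x ∂μ, (s i : Lp ℝ 2 μ) x = levelSlice t i ((u : Lp ℝ 2 μ) x) := by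
  choose T hT _ using fun i => E.exists_min_const hu (ht i)
  refine ⟨fun i => T (i + 1) - T i, fun i => ?_⟩
  filter_upwards [E.coeFn_sub (T (i + 1)) (T i), hT i, hT (i + 1)] with x hsub hTi hTi_succ
  rw [hsub, hTi, hTi_succ, levelSlice]

section LevelSlices

variable {t : ℕ → ℝ} {u : E.domain} {s : ℕ → E.domain}

theorem form_levelSlice_levelSlice_nonneg (ht : Monotone t)
    (hs : ∀ i, ∀ᵐ x ∂μ, (s i : Lp ℝ 2 μ) x = levelSlice t i ((u : Lp ℝ 2 μ) x)) {i j : ℕ}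
    (hij : i ≠ j) : 0 ≤ E.form (s i) (s j) := by
  wlog hlt : i < j generalizing i j
  · rw [E.symm]
    exact this hij.symm (hij.lt_or_gt.resolve_left hlt)
  refine E.form_levelSlice_nonneg ht (hs i) ?_ ?_
  · filter_upwards [hs j] with x hs
    rw [hs]
    exact levelSlice_nonneg ht j _
  · filter_upwards [hs j] with x hs hux
    rw [hs, levelSlice_of_le ht (hux.trans (ht hlt))]

theorem coeFn_sum_smul_levelSlice
    (hs : ∀ i, ∀ᵐ x ∂μ, (s i : Lp ℝ 2 μ) x = levelSlice t i ((u : Lp ℝ 2 μ) x)) (b : ℕ → ℝ)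
    (m : ℕ) :
    ∀ᵐ x ∂μ, ((∑ i ∈ Finset.range m, b i • s i : E.domain) : Lp ℝ 2 μ) x
      = piecewiseLinear t b m ((u : Lp ℝ 2 μ) x) := by
  filter_upwards [E.coeFn_sum_smul (Finset.range m) b s, ae_all_iff.2 hs] with x hsum hs
  simp only [hsum, hs, piecewiseLinear]

theorem form_levelSlice_sub_sum_nonneg (ht : Monotone t) (ht₀ : t 0 = 0)
    (hu : ∀ᵐ x ∂μ, 0 ≤ (u : Lp ℝ 2 μ) x)
    (hs : ∀ i, ∀ᵐ x ∂μ, (s i : Lp ℝ 2 μ) x = levelSlice t i ((u : Lp ℝ 2 μ) x)) {i m : ℕ}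
    (him : i < m) : 0 ≤ E.form (s i) (u - ∑ j ∈ Finset.range m, s j) := by
  have hrest : ∀ᵐ x ∂μ, ((u - ∑ j ∈ Finset.range m, s j : E.domain) : Lp ℝ 2 μ) x
      = (u : Lp ℝ 2 μ) x - min ((u : Lp ℝ 2 μ) x) (t m) := by
    have hone := E.coeFn_sum_smul_levelSlice hs 1 m
    simp only [Pi.one_apply, one_smul] at hone
    filter_upwards [E.coeFn_sub u (∑ j ∈ Finset.range m, s j), hone, hu] with x hsub hone hu
    rw [hsub, hone, piecewiseLinear_one (ht₀.trans_le hu), ht₀, sub_zero]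
  refine E.form_levelSlice_nonneg ht (hs i) ?_ ?_
  · filter_upwards [hrest] with x hrest
    rw [hrest]
    exact sub_nonneg.2 (min_le_left _ _)
  · filter_upwards [hrest] with x hrest hux
    rw [hrest, min_eq_left (hux.trans (ht him)), sub_self]

end LevelSlices

/-- A discrete Stroock–Varopoulos inequality: it plays the role of `ℰ(G(u), G(u)) ≤ ℰ(u, F(u))` for
`F' = (G')²`. -/
theorem exists_piecewiseLinear_form_le {t : ℕ → ℝ} (ht : Monotone t)
    (ht₀ : t 0 = 0) {u : E.domain} (hu : ∀ᵐ x ∂μ, 0 ≤ (u : Lp ℝ 2 μ) x) (b : ℕ → ℝ) (m : ℕ) :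
    ∃ g f : E.domain,
      (∀ᵐ x ∂μ, (g : Lp ℝ 2 μ) x = piecewiseLinear t b m ((u : Lp ℝ 2 μ) x)) ∧
      (∀ᵐ x ∂μ, (f : Lp ℝ 2 μ) x = piecewiseLinear t (b ^ 2) m ((u : Lp ℝ 2 μ) x)) ∧
      E.form g g ≤ E.form u f := by
  obtain ⟨s, hs⟩ := E.exists_levelSlice (fun i => ht₀.symm.trans_le (ht i.zero_le)) hu
  refine ⟨_, _, E.coeFn_sum_smul_levelSlice hs b m, E.coeFn_sum_smul_levelSlice hs (b ^ 2) m, ?_⟩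
  simp only [Pi.pow_apply]
  set p := ∑ i ∈ Finset.range m, s i
  set f := ∑ i ∈ Finset.range m, b i ^ 2 • s i with hf
  have hrest : 0 ≤ E.form (u - p) f := by
    rw [hf, map_sum]
    refine Finset.sum_nonneg fun i hi => ?_
    rw [map_smul, E.symm]
    exact smul_nonneg (sq_nonneg _)
      (E.form_levelSlice_sub_sum_nonneg ht ht₀ hu hs (Finset.mem_range.1 hi))
  calc E.form (∑ i ∈ Finset.range m, b i • s i) (∑ i ∈ Finset.range m, b i • s i)
      ≤ E.form p f := apply_sum_smul_self_le E.symm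
        (fun i _ j _ hij => E.form_levelSlice_levelSlice_nonneg ht hs hij) b
    _ ≤ E.form p f + E.form (u - p) f := le_add_of_nonneg_right hrest
    _ = E.form u f := by rw [← LinearMap.add_apply, ← map_add, add_sub_cancel]

end DirichletForm

section Measure

variable {α : Type*} [MeasurableSpace α] {μ : Measure α}

theorem ofReal_integral_le_lintegral_ofReal (f : α → ℝ) :
    ENNReal.ofReal (∫ x, f x ∂μ) ≤ ∫⁻ x, ENNReal.ofReal (f x) ∂μ := by
  by_cases hf : Integrable f μ
  · rw [integral_eq_lintegral_pos_part_sub_lintegral_neg_part hf]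
    exact (ENNReal.ofReal_le_ofReal (sub_le_self _ ENNReal.toReal_nonneg)).trans
      ENNReal.ofReal_toReal_le
  · rw [integral_undef hf, ENNReal.ofReal_zero]
    exact zero_le

theorem tendsto_setLIntegral_lt_atTop [IsFiniteMeasure μ] {v : α → ℝ} (hv : Measurable v)
    {h : α → ENNReal} (hh : ∫⁻ x, h x ∂μ ≠ ⊤) :
    Tendsto (fun T => ∫⁻ x in {x | T < v x}, h x ∂μ) atTop (𝓝 0) := by
  refine tendsto_setLIntegral_zero hh ?_
  have hinter : ⋂ T, {x | T < v x} = ∅ :=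
    Set.eq_empty_of_forall_notMem fun x hx =>
      lt_irrefl (v x) (Set.mem_iInter.1 hx (v x))
  rw [← measure_empty (μ := μ), ← hinter]
  exact tendsto_measure_iInter_atTop
    (fun T => (measurableSet_lt measurable_const hv).nullMeasurableSet)
    (fun _ _ hST _ hx => hST.trans_lt hx) ⟨0, measure_ne_top _ _⟩

theorem memLp_rpow_iff_of_nonneg {v : α → ℝ} (hv : AEStronglyMeasurable v μ)
    (hv₀ : ∀ᵐ x ∂μ, 0 ≤ v x) {q : ℝ} (hq : 0 < q) (r : ENNReal) :
    MemLp (fun x => v x ^ q) r μ ↔ MemLp v (ENNReal.ofReal q * r) μ := by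
  have hq₀ : ENNReal.ofReal q ≠ 0 := (ENNReal.ofReal_pos.2 hq).ne'
  have habs : (fun x => v x ^ q) =ᵐ[μ] fun x => ‖v x‖ ^ (ENNReal.ofReal q).toReal := by
    filter_upwards [hv₀] with x hx
    rw [ENNReal.toReal_ofReal hq.le, Real.norm_of_nonneg hx]
  rw [memLp_congr_ae habs, ← memLp_norm_rpow_iff hv hq₀ ENNReal.ofReal_ne_top, mul_comm,
    ENNReal.mul_div_cancel_right hq₀ ENNReal.ofReal_ne_top]

theorem memLp_rpow_of_eLpNorm_min_rpow_le {v : α → ℝ} (hv : AEStronglyMeasurable v μ) {q : ℝ}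
    {r C : ENNReal} (hC : C ≠ ⊤)
    (h : ∀ N : ℝ, 0 ≤ N → eLpNorm (fun x => min (v x) N ^ q) r μ ≤ C) :
    MemLp (fun x => v x ^ q) r μ := by
  refine ⟨(hv.aemeasurable.pow_const q).aestronglyMeasurable, lt_of_le_of_lt ?_ hC.lt_top⟩
  refine Lp.eLpNorm_le_of_ae_tendsto (u := atTop) (f := fun (n : ℕ) x => min (v x) n ^ q)
    (.of_forall fun n => h n n.cast_nonneg)
    (fun n => ((hv.aemeasurable.min aemeasurable_const).pow_const q).aestronglyMeasurable)
    (.of_forall fun x => tendsto_const_nhds.congr' ?_)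
  filter_upwards [eventually_ge_atTop ⌈v x⌉₊] with n hn
  rw [min_eq_left (Nat.ceil_le.1 hn)]

theorem exists_norm_piecewiseLinear_truncPowSlope_le {p : ENNReal} {v : α → ℝ} (hv : MemLp v p μ)
    (hv₀ : ∀ᵐ x ∂μ, 0 ≤ v x) {σ : ℝ} (hσ : 0 ≤ σ) (hpow : MemLp (fun x => v x ^ (σ + 1)) p μ) :
    ∃ R : ℝ, ∀ N : ℝ, 0 ≤ N → ∀ (m : ℕ) (g : Lp ℝ p μ),
      (∀ᵐ x ∂μ, g x = piecewiseLinear dyadicLevel (truncPowSlope σ N) m (v x)) → ‖g‖ ≤ R := by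
  have hsum : MemLp (fun x => v x + 2 ^ σ * v x ^ (σ + 1)) p μ := hv.add (hpow.const_mul _)
  refine ⟨‖hsum.toLp‖, fun N hN m g hg => Lp.norm_le_norm_of_ae_le ?_⟩
  filter_upwards [hv₀, hg, hsum.coeFn_toLp] with x hv₀ hg hsum
  rw [hg, hsum, Real.norm_of_nonneg (piecewiseLinear_nonneg dyadicLevel_monotone
    (isDoubling_truncPowSlope hσ hN).nonneg m _)]
  exact (piecewiseLinear_truncPowSlope_le hσ hN hv₀ m).trans (le_abs_self _)

end Measure

namespace DirichletForm

variable {M : Type*} [MeasurableSpace M] {μ : Measure M} [IsFiniteMeasure μ] {E : DirichletForm μ}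

theorem SobolevInequality.eLpNorm_le {ν A B : ℝ} (hSob : E.SobolevInequality ν A B) {v : E.domain}
    {Λ R : ℝ} (hΛ : E.form v v ≤ Λ) (hR : ‖v‖ ≤ R) :
    eLpNorm ((v : Lp ℝ 2 μ) : M → ℝ) (ENNReal.ofReal (2 * ν / (ν - 2))) μ
      ≤ ENNReal.ofReal (|A| * Λ + |B| * R ^ 2) ^ (2 : ℝ)⁻¹ := by
  rw [ENNReal.le_rpow_inv_iff two_pos, ENNReal.rpow_two]
  refine (hSob v).trans (ENNReal.ofReal_le_ofReal ?_)
  have := E.nonneg v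
  gcongr
  exacts [le_abs_self A, le_abs_self B]

theorem IsSolution.ofReal_form_le {W : M → ℝ} {u : E.domain} (hsol : E.IsSolution W u)
    (hu : ∀ᵐ x ∂μ, 0 ≤ (u : Lp ℝ 2 μ) x) {φ : E.domain} (hφ₀ : ∀ᵐ x ∂μ, 0 ≤ (φ : Lp ℝ 2 μ) x)
    (hφ : ∃ C, ∀ᵐ x ∂μ, (φ : Lp ℝ 2 μ) x ≤ C) {g : M → ℝ} {K D T : ℝ} (hK : 0 ≤ K) (hD : 0 ≤ D)
    (hlow : ∀ᵐ x ∂μ, (u : Lp ℝ 2 μ) x ≤ T → (u : Lp ℝ 2 μ) x * (φ : Lp ℝ 2 μ) x ≤ K * g x ^ 2)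
    (hhigh : ∀ᵐ x ∂μ, T < (u : Lp ℝ 2 μ) x → (φ : Lp ℝ 2 μ) x ≤ D * (u : Lp ℝ 2 μ) x) :
    ENNReal.ofReal (E.form u φ) ≤
      ENNReal.ofReal K * ∫⁻ x, ENNReal.ofReal (max (W x) 0 * g x ^ 2) ∂μ
        + ENNReal.ofReal D * ∫⁻ x in {x | T < (u : Lp ℝ 2 μ) x},
            ENNReal.ofReal (max (W x) 0 * (u : Lp ℝ 2 μ) x ^ 2) ∂μ := by
  have hS : MeasurableSet {x | T < (u : Lp ℝ 2 μ) x} :=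
    measurableSet_lt measurable_const (Lp.stronglyMeasurable _).measurable
  have hφ_abs : ∃ C, ∀ᵐ x ∂μ, |(φ : Lp ℝ 2 μ) x| ≤ C := hφ.imp fun C hC => by
    filter_upwards [hφ₀, hC] with x hx₀ hxC
    rwa [abs_of_nonneg hx₀]
  have hpos : ∀ {w a b κ : ℝ}, 0 ≤ a → 0 ≤ κ → a ≤ κ * b →
      ENNReal.ofReal (w * a) ≤ ENNReal.ofReal κ * ENNReal.ofReal (max w 0 * b) :=
    fun {w a b κ} ha hκ hab => by
    rw [← ENNReal.ofReal_mul hκ]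
    refine ENNReal.ofReal_le_ofReal ?_
    calc w * a ≤ max w 0 * a := by gcongr; exact le_max_left w 0
      _ ≤ max w 0 * (κ * b) := by gcongr
      _ = κ * (max w 0 * b) := by ring
  rw [(hsol φ hφ_abs).2]
  refine (ofReal_integral_le_lintegral_ofReal _).trans ?_
  rw [← lintegral_add_compl _ hS, add_comm, ← lintegral_const_mul' _ _ ENNReal.ofReal_ne_top,
    ← lintegral_const_mul' _ _ ENNReal.ofReal_ne_top]
  refine add_le_add
    ((setLIntegral_mono_ae' hS.compl ?_).trans (setLIntegral_le_lintegral _ _))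
    (setLIntegral_mono_ae' hS ?_)
  · filter_upwards [hu, hφ₀, hlow] with x hu hφ hlow hx
    rw [mul_assoc]
    exact hpos (mul_nonneg hu hφ) hK (hlow (not_lt.1 hx))
  · filter_upwards [hu, hφ₀, hhigh] with x hu hφ hhigh hx
    rw [mul_assoc]
    refine hpos (mul_nonneg hu hφ) hD ?_
    rw [sq, mul_left_comm]
    exact mul_le_mul_of_nonneg_left (hhigh hx) hu

theorem IsSolution.ofReal_form_piecewiseLinear_le {W : M → ℝ} {u : E.domain}
    (hsol : E.IsSolution W u) (hu : ∀ᵐ x ∂μ, 0 ≤ (u : Lp ℝ 2 μ) x) {β D : ℝ} {b : ℕ → ℝ}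
    (hb : IsDoubling β b) (hbD : ∀ i, b i ≤ D) {m : ℕ} (hm : 0 < m) {f g : E.domain}
    (hg : ∀ᵐ x ∂μ, (g : Lp ℝ 2 μ) x = piecewiseLinear dyadicLevel b m ((u : Lp ℝ 2 μ) x))
    (hf : ∀ᵐ x ∂μ, (f : Lp ℝ 2 μ) x = piecewiseLinear dyadicLevel (b ^ 2) m ((u : Lp ℝ 2 μ) x)) :
    ENNReal.ofReal (E.form u f)
      ≤ ENNReal.ofReal (4 * β) * ∫⁻ x, ENNReal.ofReal (max (W x) 0 * (g : Lp ℝ 2 μ) x ^ 2) ∂μ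
        + ENNReal.ofReal (D ^ 2) * ∫⁻ x in {x | dyadicLevel m < (u : Lp ℝ 2 μ) x},
            ENNReal.ofReal (max (W x) 0 * (u : Lp ℝ 2 μ) x ^ 2) ∂μ := by
  have hβ := zero_le_one.trans hb.one_le
  have hbD_sq : ∀ i, (b ^ 2) i ≤ D ^ 2 := fun i => pow_le_pow_left₀ (hb.nonneg i) (hbD i) 2
  refine hsol.ofReal_form_le hu ?_ ⟨D ^ 2 * dyadicLevel m, ?_⟩ (by positivity) (sq_nonneg D) ?_ ?_
  · filter_upwards [hf] with x hf
    rw [hf]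
    exact piecewiseLinear_nonneg dyadicLevel_monotone (fun i => sq_nonneg (b i)) m _
  · filter_upwards [hu, hf] with x hu hf
    rw [hf]
    exact (piecewiseLinear_le_mul_min hbD_sq hu m).trans (by gcongr; exact min_le_right _ _)
  · filter_upwards [hu, hf, hg] with x hu hf hg hum
    rw [hf, hg]
    exact hb.mul_piecewiseLinear_sq_le hu hm hum
  · filter_upwards [hu, hf] with x hu hf _
    rw [hf]
    exact (piecewiseLinear_le_mul_min hbD_sq hu m).trans (by gcongr; exact min_le_left _ _)

/-- The potential term is absorbed into the energy on the left, except for its contribution from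
beyond the last level, which becomes small as that level tends to infinity. -/
theorem IsSolution.eventually_exists_piecewiseLinear_form_le {W : M → ℝ} {u : E.domain}
    (hsol : E.IsSolution W u) (hu : ∀ᵐ x ∂μ, 0 ≤ (u : Lp ℝ 2 μ) x) {β c D : ℝ} {b : ℕ → ℝ}
    (hb : IsDoubling β b) (hbD : ∀ i, b i ≤ D) (hc₀ : 0 ≤ c)
    (hc : ∀ v : E.domain, ∫⁻ x, ENNReal.ofReal (max (W x) 0 * (v : Lp ℝ 2 μ) x ^ 2) ∂μ
      ≤ ENNReal.ofReal ((8 * β)⁻¹ * E.form v v + c * ‖v‖ ^ 2)) :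
    ∀ᶠ m in atTop, ∃ g : E.domain,
      (∀ᵐ x ∂μ, (g : Lp ℝ 2 μ) x = piecewiseLinear dyadicLevel b m ((u : Lp ℝ 2 μ) x)) ∧
      E.form g g ≤ 8 * β * c * ‖g‖ ^ 2 + 2 := by
  have hβ : 0 < β := zero_lt_one.trans_le hb.one_le
  have htail : Tendsto (fun m => ENNReal.ofReal (D ^ 2) *
      ∫⁻ x in {x | dyadicLevel m < (u : Lp ℝ 2 μ) x},
        ENNReal.ofReal (max (W x) 0 * (u : Lp ℝ 2 μ) x ^ 2) ∂μ) atTop (𝓝 0) := by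
    have hlim := ENNReal.Tendsto.const_mul (a := ENNReal.ofReal (D ^ 2))
      ((tendsto_setLIntegral_lt_atTop (Lp.stronglyMeasurable (u : Lp ℝ 2 μ)).measurable
        (ne_top_of_le_ne_top ENNReal.ofReal_ne_top (hc u))).comp tendsto_dyadicLevel)
      (Or.inr ENNReal.ofReal_ne_top)
    rwa [mul_zero] at hlim
  filter_upwards [eventually_gt_atTop 0, htail.eventually_le_const one_pos] with m hm htail
  obtain ⟨g, f, hg, hf, hgf⟩ :=
    E.exists_piecewiseLinear_form_le dyadicLevel_monotone rfl hu b m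
  have henergy : ENNReal.ofReal (E.form g g)
      ≤ ENNReal.ofReal (4 * β * ((8 * β)⁻¹ * E.form g g + c * ‖g‖ ^ 2) + 1) := by
    have := E.nonneg g
    rw [ENNReal.ofReal_add (by positivity) zero_le_one, ENNReal.ofReal_mul (by positivity),
      ENNReal.ofReal_one]
    refine (ENNReal.ofReal_le_ofReal hgf).trans ?_
    refine (hsol.ofReal_form_piecewiseLinear_le hu hb hbD hm hg hf).trans ?_
    gcongr
    exact hc g
  have hmain := (ENNReal.ofReal_le_ofReal_iff (by have := E.nonneg g; positivity)).1 henergy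
  refine ⟨g, hg, ?_⟩
  have hhalf : 4 * β * ((8 * β)⁻¹ * E.form g g) = E.form g g / 2 := by field_simp; ring
  linarith

theorem IsSolution.exists_eLpNorm_min_rpow_le {ν A B : ℝ} (hSob : E.SobolevInequality ν A B)
    {W : M → ℝ} (hW : E.InfinitesimallyFormBounded fun x => max (W x) 0) {u : E.domain}
    (hsol : E.IsSolution W u) (hu : ∀ᵐ x ∂μ, 0 ≤ (u : Lp ℝ 2 μ) x) {σ : ℝ} (hσ : 0 ≤ σ)
    (hmem : MemLp (fun x => (u : Lp ℝ 2 μ) x ^ (σ + 1)) 2 μ) :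
    ∃ C : ENNReal, C ≠ ⊤ ∧ ∀ N : ℝ, 0 ≤ N →
      eLpNorm (fun x => min ((u : Lp ℝ 2 μ) x) N ^ (σ + 1)) (ENNReal.ofReal (2 * ν / (ν - 2))) μ
        ≤ C := by
  obtain ⟨c, hc₀, hc⟩ := hW (8 * 2 ^ σ)⁻¹ (by positivity)
  obtain ⟨R, hR⟩ :=
    exists_norm_piecewiseLinear_truncPowSlope_le (Lp.memLp (u : Lp ℝ 2 μ)) hu hσ hmem
  let S : ENNReal :=
    ENNReal.ofReal (|A| * (8 * 2 ^ σ * c * R ^ 2 + 2) + |B| * R ^ 2) ^ (2 : ℝ)⁻¹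
  refine ⟨ENNReal.ofReal (4 * 2 ^ σ) * S, by finiteness, fun N hN => ?_⟩
  have hb := isDoubling_truncPowSlope hσ hN
  obtain ⟨m, ⟨g, hg, henergy⟩, hm, hNm⟩ :=
    ((hsol.eventually_exists_piecewiseLinear_form_le hu hb (truncPowSlope_le hσ hN) hc₀ hc).and
      ((eventually_gt_atTop 0).and (tendsto_dyadicLevel.eventually_ge_atTop N))).exists
  have hg₀ : ∀ᵐ x ∂μ, 0 ≤ (g : Lp ℝ 2 μ) x := by
    filter_upwards [hg] with x hg
    rw [hg]
    exact piecewiseLinear_nonneg dyadicLevel_monotone hb.nonneg m _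
  have hgR : ‖g‖ ≤ R := hR N hN m g hg
  have hgS : eLpNorm ((g : Lp ℝ 2 μ) : M → ℝ) (ENNReal.ofReal (2 * ν / (ν - 2))) μ ≤ S :=
    hSob.eLpNorm_le (henergy.trans (by gcongr)) hgR
  refine (eLpNorm_le_mul_eLpNorm_of_ae_le_mul ?_ _).trans (mul_le_mul_right hgS _)
  filter_upwards [hu, hg, hg₀] with x hu hg hg₀
  rw [Real.norm_of_nonneg (by positivity), Real.norm_of_nonneg hg₀, hg]
  exact min_rpow_le_piecewiseLinear_truncPowSlope hσ hN hu hm hNm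

theorem IsSolution.memLp_mul_sobolevExponent {ν A B : ℝ} (hSob : E.SobolevInequality ν A B)
    {W : M → ℝ} (hW : E.InfinitesimallyFormBounded fun x => max (W x) 0) {u : E.domain}
    (hsol : E.IsSolution W u) (hu : ∀ᵐ x ∂μ, 0 ≤ (u : Lp ℝ 2 μ) x) {q : ℝ} (hq : 1 ≤ q)
    (hmem : MemLp ((u : Lp ℝ 2 μ) : M → ℝ) (ENNReal.ofReal q * 2) μ) :
    MemLp ((u : Lp ℝ 2 μ) : M → ℝ)
      (ENNReal.ofReal q * ENNReal.ofReal (2 * ν / (ν - 2))) μ := by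
  have hu_meas := Lp.aestronglyMeasurable (u : Lp ℝ 2 μ)
  have hq₀ : 0 < q := one_pos.trans_le hq
  rw [← memLp_rpow_iff_of_nonneg hu_meas hu hq₀] at hmem ⊢
  rw [← sub_add_cancel q 1] at hmem ⊢
  obtain ⟨C, hC, hle⟩ := hsol.exists_eLpNorm_min_rpow_le hSob hW hu (sub_nonneg.2 hq) hmem
  exact memLp_rpow_of_eLpNorm_min_rpow_le hu_meas hC hle

end DirichletForm

theorem mainTheorem6_general {M : Type*} [MeasurableSpace M] {μ : Measure M} [IsFiniteMeasure μ]
    (E : DirichletForm μ) {ν A B : ℝ} (hν : 2 < ν) (hSob : E.SobolevInequality ν A B) {W : M → ℝ}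
    (hWpos : E.InfinitesimallyFormBounded fun x => max (W x) 0) {u : E.domain}
    (hu : 0 ≤ (u : Lp ℝ 2 μ)) (hsol : E.IsSolution W u) {p : ENNReal} (hp : p ≠ ⊤) :
    MemLp ((u : Lp ℝ 2 μ) : M → ℝ) p μ := by
  have hν₂ : 0 < ν - 2 := sub_pos.2 hν
  have hκ : 1 < ν / (ν - 2) := (one_lt_div hν₂).2 (sub_lt_self ν two_pos)
  have hexp : ENNReal.ofReal (2 * ν / (ν - 2)) = ENNReal.ofReal (ν / (ν - 2)) * 2 := by
    rw [mul_comm 2 ν, mul_div_right_comm, ENNReal.ofReal_mul (by positivity),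
      ENNReal.ofReal_ofNat]
  have hu₀ : ∀ᵐ x ∂μ, 0 ≤ (u : Lp ℝ 2 μ) x := (Lp.coeFn_nonneg _).2 hu
  have hiter : ∀ k : ℕ,
      MemLp ((u : Lp ℝ 2 μ) : M → ℝ) (ENNReal.ofReal ((ν / (ν - 2)) ^ k) * 2) μ := fun k => by
    induction k with
    | zero => simpa only [pow_zero, ENNReal.ofReal_one, one_mul] using Lp.memLp (u : Lp ℝ 2 μ)
    | succ k ih =>
      rw [pow_succ, ENNReal.ofReal_mul (by positivity), mul_assoc, ← hexp]
      exact hsol.memLp_mul_sobolevExponent hSob hWpos hu₀ (one_le_pow₀ hκ.le) ih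
  obtain ⟨k, hk⟩ := pow_unbounded_of_one_lt p.toReal hκ
  refine (hiter k).mono_exponent ?_
  calc p = ENNReal.ofReal p.toReal := (ENNReal.ofReal_toReal hp).symm
    _ ≤ ENNReal.ofReal ((ν / (ν - 2)) ^ k) := ENNReal.ofReal_le_ofReal hk.le
    _ ≤ ENNReal.ofReal ((ν / (ν - 2)) ^ k) * 2 := le_mul_of_one_le_right' one_le_two

theorem mainTheorem6 {M : Type*} [TopologicalSpace M] [CompactSpace M]
    [MeasurableSpace M] [BorelSpace M] (μ : Measure M) [IsFiniteMeasure μ] [μ.Regular]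
    (E : DirichletForm μ) (hreg : E.IsRegular) (hloc : E.StronglyLocal)
    (ν A B : ℝ) (hν : 2 < ν) (hA : 0 < A) (hB : 0 < B) (hSob : E.SobolevInequality ν A B)
    (W : M → ℝ) (hW : Integrable W μ)
    (hWpos : E.InfinitesimallyFormBounded (fun x => max (W x) 0))
    (u : E.domain) (hu : 0 ≤ (u : Lp ℝ 2 μ)) (hsol : E.IsSolution W u) :
    ∀ q : ℝ, 2 ≤ q → MemLp ((u : Lp ℝ 2 μ) : M → ℝ) (ENNReal.ofReal q) μ :=
  fun _ _ => mainTheorem6_general E hν hSob hWpos hu hsol ENNReal.ofReal_ne_top
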